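/- Let $K,T>0$. There is a constant $c=c(K,T)>0$, depending only on $K$ and $T$, such that the following holds. Let $G=(V,w,m)$ be a measured weighted graph: $V$ is a countable set, $w:V\times V\to[0,\infty)$ is symmetric and zero on the diagonal, $m:V\to(0,\infty)$, and $G$ is connected and locally finite (each $\{y: w(x,y)>0\}$ is finite). For $f,g:V\to\mathbb R$ put $$\Delta f(x)=\sum_{y\in V}\frac{w(x,y)}{m(x)}\,(f(y)-f(x)),\qquad \Gamma(f,g)=\tfrac12\big(\Delta(fg)-f\Delta g-g\Delta f\big),$$ $$\Gamma_2(f,g)=\tfrac12\big(\Delta\Gamma(f,g)-\Gamma(f,\Delta g)-\Gamma(g,\Delta f)\big),\qquad \Gamma f=\Gamma(f,f),\quad \Gamma_2f=\Gamma_2(f,f),$$ $\|f\|_1=\sum_x m(x)|f(x)|\in[0,\infty]$, $\|f\|_\infty=\sup_x|f(x)|$. Let $P_t=e^{t\Delta}$, $t\ge 0$, be the heat semigroup, $P_tf(x)=\sum_{n\ge0}\frac{t^n}{n!}\Delta^nf(x)$. Let $\rho:V\to\mathbb R$ and suppose that 1. $G$ has bounded degree: $\sup_x\sum_y w(x,y)/m(x)<\infty$;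 2. $CD(\rho,\infty)$ holds: $\Gamma_2 f(x)\ge\rho(x)\,\Gamma f(x)$ for all bounded $f:V\to\mathbb R$ and all $x\in V$; 3. with $r_-=\max\{-r,0\}$ and $k_T(W):=\sup_{n\in\mathbb N}\int_0^T\|P_t(n\wedge W)\|_\infty\,dt$ for $W:V\to[0,\infty)$, $$k_T\big((\rho-K)_-\big)<\tfrac14\big(1-e^{-KT/2}\big).$$ Then for all $f:V\to\mathbb R$ and all $t\ge0$, $$\|f-P_tf\|_1\le c\,\sqrt t\,\big\|\sqrt{\Gamma f}\big\|_1,$$ where the right-hand side is read as $0$ for $t=0$ and may be $+\infty$ for $t>0$. (Under the bounded-degree assumption the series for $P_tf$ converges absolutely at every vertex whenever $f$ is bounded or $\|\sqrt{\Gamma f}\|_1<\infty$; if $\|\sqrt{\Gamma f}\|_1=\infty$ and $t>0$ the inequality is trivially true.) -/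

import Mathlib

open scoped ENNReal Nat

/-- A measured and weighted graph on the vertex set `V`: symmetric edge weights `w ≥ 0` vanishing
on the diagonal and a vertex measure `m > 0`; locally finite and connected. -/
structure MWGraph (V : Type*) where
  w : V → V → ℝ
  m : V → ℝ
  w_nonneg : ∀ x y, 0 ≤ w x y
  w_symm : ∀ x y, w x y = w y x
  w_self : ∀ x, w x x = 0
  m_pos : ∀ x, 0 < m x
  locallyFinite : ∀ x, {y | 0 < w x y}.Finite
  connected : ∀ x y, Relation.ReflTransGen (fun a b => 0 < w a b) x y

namespace MWGraph

variable {V : Type*} (G : MWGraph V)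

/-- The finite set of neighbours of `x`. -/
noncomputable def nbrs (x : V) : Finset V := (G.locallyFinite x).toFinset

/-- `q(x,y) = w(x,y) / m(x)`. -/
noncomputable def q (x y : V) : ℝ := G.w x y / G.m x

/-- The weighted degree `Deg(x) = ∑_y q(x,y)`; all other summands vanish. -/
noncomputable def deg (x : V) : ℝ := ∑ y ∈ G.nbrs x, G.q x y

/-- `sup_x Deg(x) < ∞`. -/
def BoundedDegree : Prop := BddAbove (Set.range G.deg)

/-- The Laplacian `Δ f(x) = ∑_y q(x,y) (f(y) - f(x))`. -/
noncomputable def lap (f : V → ℝ) (x : V) : ℝ := ∑ y ∈ G.nbrs x, G.q x y * (f y - f x)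

/-- The carré du champ operator `Γ(f,g) = (Δ(fg) - f Δg - g Δf) / 2`. -/
noncomputable def Gam (f g : V → ℝ) (x : V) : ℝ :=
  (1 / 2) * (G.lap (f * g) x - f x * G.lap g x - g x * G.lap f x)

/-- `Γ₂(f,g) = (Δ Γ(f,g) - Γ(f,Δg) - Γ(g,Δf)) / 2`. -/
noncomputable def Gam2 (f g : V → ℝ) (x : V) : ℝ :=
  (1 / 2) * (G.lap (G.Gam f g) x - G.Gam f (G.lap g) x - G.Gam g (G.lap f) x)

/-- The variable curvature dimension condition `CD(ρ,n)`, `n ∈ (0,∞]` (with `1/∞ = 0`). -/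
def CD (ρ : V → ℝ) (n : ℝ≥0∞) : Prop :=
  ∀ f : V → ℝ, (∃ C, ∀ x, |f x| ≤ C) →
    ∀ x, ρ x * G.Gam f f x + (n⁻¹).toReal * (G.lap f x) ^ 2 ≤ G.Gam2 f f x

/-- The heat semigroup `P_t f = e^{tΔ} f = ∑_n t^n/n! Δ^n f`, evaluated pointwise.
For graphs of bounded degree `Δ` is a bounded operator on every `ℓ^p(V,m)`, `1 ≤ p ≤ ∞`, so that
the semigroup generated by `Δ` on these spaces is given by this absolutely convergent series
(see `summable_heat_of_bounded` and `summable_heat_of_grad`). -/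
noncomputable def heat (t : ℝ) (f : V → ℝ) (x : V) : ℝ :=
  ∑' n : ℕ, t ^ n / n ! * (G.lap^[n] f) x

/-- The weighted norm `‖f‖₁ = ∑_x m(x) |f(x)|`, with values in `[0,∞]`. -/
noncomputable def norm1 (f : V → ℝ) : ℝ≥0∞ := ∑' x, ENNReal.ofReal (G.m x * |f x|)

/-- The supremum norm, with values in `[0,∞]`. -/
noncomputable def supNorm (f : V → ℝ) : ℝ≥0∞ := ⨆ x, ENNReal.ofReal |f x|

/-- The Kato constant `k_T(W) = sup_n ∫_0^T ‖P_t (n ∧ W)‖_∞ dt`. -/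
noncomputable def kato (T : ℝ) (W : V → ℝ) : ℝ≥0∞ :=
  ⨆ n : ℕ, ∫⁻ t in Set.Ioc 0 T, supNorm (G.heat t (fun x => min (n : ℝ) (W x)))

/-! Convergence of the series defining the heat semigroup. -/

lemma q_nonneg (x y : V) : 0 ≤ G.q x y := div_nonneg (G.w_nonneg x y) (G.m_pos x).le

lemma abs_lap_le (f : V → ℝ) (x : V) :
    |G.lap f x| ≤ ∑ y ∈ G.nbrs x, G.q x y * |f y - f x| := by
  refine (Finset.abs_sum_le_sum_abs _ _).trans_eq (Finset.sum_congr rfl fun y _ => ?_)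
  rw [abs_mul, abs_of_nonneg (G.q_nonneg x y)]

lemma summable_of_pow_bound {a : ℕ → ℝ} {B C : ℝ} (t : ℝ) (h : ∀ n, |a n| ≤ B ^ n * C) :
    Summable fun n : ℕ => t ^ n / n ! * a n := by
  refine Summable.of_norm_bounded
    (((Real.summable_pow_div_factorial (|t| * B)).mul_right C)) fun n => ?_
  rw [Real.norm_eq_abs, abs_mul, abs_div, abs_pow, Nat.abs_cast, mul_pow]
  calc |t| ^ n / n ! * |a n| ≤ |t| ^ n / n ! * (B ^ n * C) := by gcongr; exact h n
    _ = _ := by ring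

lemma summable_heat_of_bounded (hG : G.BoundedDegree) {f : V → ℝ} {C : ℝ}
    (hf : ∀ x, |f x| ≤ C) (t : ℝ) (x : V) :
    Summable fun n : ℕ => t ^ n / n ! * (G.lap^[n] f) x := by
  obtain ⟨D, hD⟩ := hG
  have hD' : ∀ x, G.deg x ≤ D := fun x => hD ⟨x, rfl⟩
  refine summable_of_pow_bound (B := 2 * D) (C := C) t fun n => ?_
  induction n generalizing x with
  | zero => simpa using hf x
  | succ n ih =>
    rw [Function.iterate_succ_apply']
    refine (G.abs_lap_le _ x).trans ?_
    calc ∑ y ∈ G.nbrs x, G.q x y * |(G.lap^[n] f) y - (G.lap^[n] f) x|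
        ≤ ∑ y ∈ G.nbrs x, G.q x y * (2 * ((2 * D) ^ n * C)) := by
          refine Finset.sum_le_sum fun y _ => mul_le_mul_of_nonneg_left ?_ (G.q_nonneg x y)
          have := abs_sub ((G.lap^[n] f) y) ((G.lap^[n] f) x)
          linarith [ih x, ih y]
      _ = G.deg x * (2 * ((2 * D) ^ n * C)) := by rw [deg, Finset.sum_mul]
      _ ≤ D * (2 * ((2 * D) ^ n * C)) := by
          refine mul_le_mul_of_nonneg_right (hD' x) ?_
          linarith [ih x, abs_nonneg ((G.lap^[n] f) x)]
      _ = _ := by ring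

lemma mem_nbrs {x y : V} : y ∈ G.nbrs x ↔ 0 < G.w x y := by simp [nbrs]

lemma Gam_self (f : V → ℝ) (x : V) :
    G.Gam f f x = 1 / 2 * ∑ y ∈ G.nbrs x, G.q x y * (f y - f x) ^ 2 := by
  simp only [Gam, lap, Pi.mul_apply, Finset.mul_sum, ← Finset.sum_sub_distrib]
  exact Finset.sum_congr rfl fun y _ => by ring

lemma abs_lap_le_sqrt_Gam {D : ℝ} (hD : ∀ x, G.deg x ≤ D) (f : V → ℝ) (x : V) :
    |G.lap f x| ≤ Real.sqrt (2 * D) * Real.sqrt (G.Gam f f x) := by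
  have hdeg : 0 ≤ G.deg x := Finset.sum_nonneg fun y _ => G.q_nonneg x y
  have hΓ : 0 ≤ G.Gam f f x := by
    rw [Gam_self]
    exact mul_nonneg (by norm_num)
      (Finset.sum_nonneg fun y _ => mul_nonneg (G.q_nonneg x y) (sq_nonneg _))
  rw [← Real.sqrt_mul (by linarith [hD x])]
  refine Real.abs_le_sqrt ?_
  have h := Finset.sum_sq_le_sum_mul_sum_of_sq_le_mul (G.nbrs x) (f := fun y => G.q x y)
    (g := fun y => G.q x y * (f y - f x) ^ 2) (r := fun y => G.q x y * (f y - f x))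
    (fun y _ => G.q_nonneg x y) (fun y _ => mul_nonneg (G.q_nonneg x y) (sq_nonneg _))
    (fun y _ => le_of_eq (by ring))
  have e : ∑ y ∈ G.nbrs x, G.q x y * (f y - f x) ^ 2 = 2 * G.Gam f f x := by
    rw [Gam_self]; ring
  rw [e] at h
  calc (G.lap f x) ^ 2 ≤ G.deg x * (2 * G.Gam f f x) := h
    _ ≤ D * (2 * G.Gam f f x) := mul_le_mul_of_nonneg_right (hD x) (by linarith)
    _ = _ := by ring

lemma tsum_w_le {D : ℝ} (hD : ∀ x, G.deg x ≤ D) (x : V) :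
    ∑' y, ENNReal.ofReal (G.w x y) ≤ ENNReal.ofReal (D * G.m x) := by
  rw [tsum_eq_sum (s := G.nbrs x), ← ENNReal.ofReal_sum_of_nonneg fun y _ => G.w_nonneg x y]
  · refine ENNReal.ofReal_le_ofReal ?_
    have h : ∑ y ∈ G.nbrs x, G.w x y = G.deg x * G.m x := by
      rw [deg, Finset.sum_mul]
      exact Finset.sum_congr rfl fun y _ => by rw [q, div_mul_cancel₀ _ (G.m_pos x).ne']
    rw [h]
    exact mul_le_mul_of_nonneg_right (hD x) (G.m_pos x).le
  · intro y hy
    rw [mem_nbrs] at hy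
    simpa using not_lt.1 hy

lemma norm1_lap_le {D : ℝ} (hD0 : 0 ≤ D) (hD : ∀ x, G.deg x ≤ D) (g : V → ℝ) :
    G.norm1 (G.lap g) ≤ ENNReal.ofReal (2 * D) * G.norm1 g := by
  have hx : ∀ x, ENNReal.ofReal (G.m x * |G.lap g x|) ≤
      ∑' y, ENNReal.ofReal (G.w x y) * ENNReal.ofReal |g y| +
      ∑' y, ENNReal.ofReal (G.w x y) * ENNReal.ofReal |g x| := by
    intro x
    rw [← ENNReal.tsum_add]
    refine le_trans ?_ (ENNReal.sum_le_tsum (G.nbrs x))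
    have : ∀ y, ENNReal.ofReal (G.w x y) * ENNReal.ofReal |g y| +
        ENNReal.ofReal (G.w x y) * ENNReal.ofReal |g x| =
        ENNReal.ofReal (G.w x y * (|g y| + |g x|)) := fun y => by
      rw [mul_add, ENNReal.ofReal_add (mul_nonneg (G.w_nonneg x y) (abs_nonneg _))
        (mul_nonneg (G.w_nonneg x y) (abs_nonneg _)), ENNReal.ofReal_mul (G.w_nonneg x y),
        ENNReal.ofReal_mul (G.w_nonneg x y)]
    simp only [this]
    rw [← ENNReal.ofReal_sum_of_nonneg fun y _ =>
      mul_nonneg (G.w_nonneg x y) (add_nonneg (abs_nonneg _) (abs_nonneg _))]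
    refine ENNReal.ofReal_le_ofReal
      ((mul_le_mul_of_nonneg_left (G.abs_lap_le g x) (G.m_pos x).le).trans ?_)
    rw [Finset.mul_sum]
    refine Finset.sum_le_sum fun y _ => ?_
    rw [← mul_assoc, q, mul_div_cancel₀ _ (G.m_pos x).ne']
    exact mul_le_mul_of_nonneg_left (abs_sub _ _) (G.w_nonneg x y)
  have hy : ∀ x, (∑' y, ENNReal.ofReal (G.w x y)) * ENNReal.ofReal |g x| ≤
      ENNReal.ofReal D * ENNReal.ofReal (G.m x * |g x|) := fun x => by
    rw [ENNReal.ofReal_mul (G.m_pos x).le, ← mul_assoc, ← ENNReal.ofReal_mul hD0]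
    exact mul_le_mul_left (G.tsum_w_le hD x) _
  refine (ENNReal.tsum_le_tsum hx).trans ?_
  rw [ENNReal.tsum_add, ENNReal.tsum_comm]
  simp only [ENNReal.tsum_mul_right]
  have h2 := ENNReal.tsum_le_tsum hy
  rw [ENNReal.tsum_mul_left] at h2
  calc _ ≤ ENNReal.ofReal D * G.norm1 g + ENNReal.ofReal D * G.norm1 g := by
        refine add_le_add (le_trans (le_of_eq ?_) h2) h2
        refine tsum_congr fun y => ?_
        congr 1
        exact tsum_congr fun x => by rw [G.w_symm x y]
    _ = _ := by rw [← add_mul, ← ENNReal.ofReal_add hD0 hD0, two_mul]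

lemma summable_heat_of_grad (hG : G.BoundedDegree) {f : V → ℝ}
    (hf : G.norm1 (fun x => Real.sqrt (G.Gam f f x)) ≠ ∞) (t : ℝ) (x : V) :
    Summable fun n : ℕ => t ^ n / n ! * (G.lap^[n] f) x := by
  obtain ⟨D, hD⟩ := hG
  have hD' : ∀ x, G.deg x ≤ D := fun x => hD ⟨x, rfl⟩
  have hD0 : 0 ≤ D := (Finset.sum_nonneg fun y _ => G.q_nonneg x y).trans (hD' x)
  have h1 : G.norm1 (G.lap f) ≠ ∞ := by
    refine ne_top_of_le_ne_top (ENNReal.mul_ne_top (ENNReal.ofReal_ne_top (r := √(2 * D))) hf) ?_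
    rw [norm1, norm1, ← ENNReal.tsum_mul_left]
    refine ENNReal.tsum_le_tsum fun x => ?_
    rw [← ENNReal.ofReal_mul (Real.sqrt_nonneg _), abs_of_nonneg (Real.sqrt_nonneg _)]
    refine ENNReal.ofReal_le_ofReal ?_
    have := mul_le_mul_of_nonneg_left (G.abs_lap_le_sqrt_Gam hD' f x) (G.m_pos x).le
    linarith
  have h2 : ∀ n, G.norm1 (G.lap^[n + 1] f) ≤
      ENNReal.ofReal ((2 * D) ^ n) * G.norm1 (G.lap f) := by
    intro n
    induction n with
    | zero => simp
    | succ n ih =>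
      rw [Function.iterate_succ_apply', pow_succ', ENNReal.ofReal_mul (by positivity), mul_assoc]
      exact (G.norm1_lap_le hD0 hD' _).trans (by gcongr)
  have h3 : ∀ n, |(G.lap^[n + 1] f) x| ≤ (2 * D) ^ n * ((G.norm1 (G.lap f)).toReal / G.m x) := by
    intro n
    have h := (ENNReal.le_tsum x).trans (h2 n)
    rw [← ENNReal.ofReal_toReal h1, ← ENNReal.ofReal_mul (by positivity),
      ENNReal.ofReal_le_ofReal_iff (by positivity)] at h
    rw [← mul_div_assoc, le_div_iff₀ (G.m_pos x)]
    linarith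
  set N := (G.norm1 (G.lap f)).toReal / G.m x
  have hN : 0 ≤ N := div_nonneg ENNReal.toReal_nonneg (G.m_pos x).le
  refine summable_of_pow_bound (B := 2 * D + 1) (C := |f x| + N) t fun n => ?_
  cases n with
  | zero => simpa using hN
  | succ n =>
    refine (h3 n).trans ?_
    have : (2 * D) ^ n ≤ (2 * D + 1) ^ (n + 1) :=
      (pow_le_pow_left₀ (by positivity) (by linarith) n).trans
        (pow_le_pow_right₀ (by linarith) (Nat.le_succ n))
    exact mul_le_mul this (by linarith [abs_nonneg (f x)]) hN (by positivity)

end MWGraph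

/-!
Put `v = 2W - 2K`, where `W` is the truncation of `(ρ - K)₋` at a height `n ≥ K + sup Deg`. As every
graph satisfies `CD(-sup Deg, ∞)`, truncating costs no curvature: `CD(K - W, ∞)` holds, that is,
`vΓ + 2Γ₂ ≥ 0`. By Khasminskii's lemma the Kato condition makes the Feynman–Kac semigroup
`Q_s = e^{s(Δ + v)}` decay, `Q_s 1 ≤ 2e^{-Ks}`.

For bounded `g` and `u_s = P_{t-s} g`, differentiate `Q_s (u_s² + 2(t - s) Γ(u_s))` in `s`. The
derivative is `Q_s (v u_s² + 2(t - s) (v Γ(u_s) + 2 Γ₂(u_s))) ≥ -2K ‖g‖² Q_s 1`. Integrated over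
`[0, t]`, the decay of `Q_s 1` gives the reverse Poincaré inequality `t Γ(P_t g) ≤ 2 ‖g‖²`.

Duality turns this into the claim: `⟨P_t f - f, g⟩ = -∫₀ᵗ ⟨1, Γ(f, P_s g)⟩ ds` is at most
`∫₀ᵗ √(2/s) ds · ‖√Γf‖₁ ‖g‖ = 2√2 √t ‖√Γf‖₁ ‖g‖`.
-/

open scoped BoundedContinuousFunction

section OperatorExponential

variable {F : Type*} [NormedAddCommGroup F] [NormedSpace ℝ F]

/-- The uniformly continuous semigroup `e^{tA}` generated by a bounded operator `A`. -/
noncomputable def opExp (A : F →L[ℝ] F) (t : ℝ) : F →L[ℝ] F := NormedSpace.exp (t • A)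

@[simp] lemma opExp_zero (A : F →L[ℝ] F) : opExp A 0 = 1 := by simp [opExp]

lemma norm_pow_apply_le (A : F →L[ℝ] F) (n : ℕ) (g : F) : ‖(A ^ n) g‖ ≤ ‖A‖ ^ n * ‖g‖ := by
  induction n with
  | zero => simp
  | succ n ih =>
    rw [pow_succ' A, pow_succ' ‖A‖, mul_assoc]
    exact A.le_opNorm_of_le ih

variable [CompleteSpace F]

lemma hasSum_opExp_apply (A : F →L[ℝ] F) (t : ℝ) (g : F) :
    HasSum (fun n : ℕ => (t ^ n / n !) • (A ^ n) g) (opExp A t g) := by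
  have h := (NormedSpace.exp_series_hasSum_exp' (𝕂 := ℝ) (t • A)).mapL
    (ContinuousLinearMap.apply ℝ F g)
  convert h using 2 with n
  · simp [smul_pow, smul_smul, div_eq_inv_mul]
  · rfl

lemma opExp_apply_of_apply_eq_zero {A : F →L[ℝ] F} {g : F} (hg : A g = 0) (t : ℝ) :
    opExp A t g = g := by
  refine (hasSum_opExp_apply A t g).unique ?_
  have hpow : ∀ n ≠ 0, (t ^ n / n !) • (A ^ n) g = 0 := fun n hn => by
    obtain ⟨k, rfl⟩ := Nat.exists_eq_succ_of_ne_zero hn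
    simp [pow_succ, hg]
  simpa using hasSum_single 0 hpow

lemma opExp_natCast_mul (A : F →L[ℝ] F) (n : ℕ) (t : ℝ) : opExp A (n * t) = opExp A t ^ n := by
  let _ : NormedAlgebra ℚ (F →L[ℝ] F) := NormedAlgebra.restrictScalars ℚ ℝ _
  rw [opExp, opExp, ← NormedSpace.exp_nsmul, mul_smul, Nat.cast_smul_eq_nsmul]

lemma opExp_add_smul_one (A : F →L[ℝ] F) (c t : ℝ) :
    opExp (A + c • 1) t = Real.exp (c * t) • opExp A t := by
  let _ : NormedAlgebra ℚ (F →L[ℝ] F) := NormedAlgebra.restrictScalars ℚ ℝ _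
  have hscalar : NormedSpace.exp ((c * t) • (1 : F →L[ℝ] F)) = Real.exp (c * t) • 1 := by
    simpa only [← Real.exp_eq_exp_ℝ, Algebra.algebraMap_eq_smul_one] using
      (NormedSpace.algebraMap_exp_comm (𝕂 := ℝ) (𝔸 := F →L[ℝ] F) (c * t)).symm
  rw [opExp, opExp, smul_add, smul_smul, mul_comm t c,
    NormedSpace.exp_add_of_commute ((Commute.one_right _).smul_right _), hscalar, mul_smul_comm,
    mul_one]

lemma hasDerivAt_opExp (A : F →L[ℝ] F) (s : ℝ) : HasDerivAt (opExp A) (opExp A s * A) s :=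
  hasDerivAt_exp_smul_const A s

lemma continuous_opExp (A : F →L[ℝ] F) : Continuous (opExp A) :=
  continuous_iff_continuousAt.2 fun s => (hasDerivAt_opExp A s).continuousAt

lemma hasDerivAt_opExp_apply (A : F →L[ℝ] F) {u : ℝ → F} {u' : F} {s : ℝ}
    (hu : HasDerivAt u u' s) :
    HasDerivAt (fun r => opExp A r (u r)) (opExp A s (A (u s) + u')) s := by
  rw [map_add]
  exact (hasDerivAt_opExp A s).clm_apply hu

lemma hasDerivAt_opExp_sub_apply (A : F →L[ℝ] F) (g : F) (t s : ℝ) :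
    HasDerivAt (fun r => opExp A (t - r) g) (-A (opExp A (t - s) g)) s := by
  have hexp : HasDerivAt (opExp A) (A * opExp A (t - s)) (t - s) :=
    hasDerivAt_exp_smul_const' A (t - s)
  simpa [Function.comp_def] using
    (hexp.clm_apply (hasDerivAt_const (t - s) g)).scomp s ((hasDerivAt_id s).const_sub t)

lemma hasSum_integral_opExp_apply (A : F →L[ℝ] F) (t : ℝ) (g : F) :
    HasSum (fun n : ℕ => (t ^ (n + 1) / (n + 1)! : ℝ) • (A ^ n) g)
      ((∫ s in 0..t, opExp A s) g) := by
  have hbound : ∀ n : ℕ, ∀ s ∈ Set.uIoc 0 t,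
      ‖(s ^ n / n !) • (A ^ n) g‖ ≤ (|t| * ‖A‖) ^ n / n ! * ‖g‖ := fun n s hs => by
    have hst : |s| ≤ |t| := by simpa using Set.abs_sub_left_of_mem_uIcc (Set.uIoc_subset_uIcc hs)
    calc ‖(s ^ n / n !) • (A ^ n) g‖ = |s| ^ n / n ! * ‖(A ^ n) g‖ := by
          simp [norm_smul]
      _ ≤ |t| ^ n / n ! * (‖A‖ ^ n * ‖g‖) := by gcongr; exact norm_pow_apply_le A n g
      _ = (|t| * ‖A‖) ^ n / n ! * ‖g‖ := by ring
  have hterm : ∀ n : ℕ, ∫ s in 0..t, (s ^ n / n !) • (A ^ n) g =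
      (t ^ (n + 1) / (n + 1)! : ℝ) • (A ^ n) g := fun n => by
    rw [intervalIntegral.integral_smul_const, intervalIntegral.integral_div, integral_pow]
    congr 1
    push_cast [Nat.factorial_succ]
    simp [div_div]
  simp only [← hterm]
  rw [ContinuousLinearMap.intervalIntegral_apply ((continuous_opExp A).intervalIntegrable 0 t)]
  exact intervalIntegral.hasSum_integral_of_dominated_convergence
    (fun n _ => (|t| * ‖A‖) ^ n / n ! * ‖g‖)
    (fun n => by fun_prop)
    (fun n => .of_forall (hbound n))
    (.of_forall fun s _ => (Real.summable_pow_div_factorial (|t| * ‖A‖)).mul_right ‖g‖)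
    intervalIntegrable_const
    (.of_forall fun s _ => hasSum_opExp_apply A s g)

end OperatorExponential

section Order

variable {X : Type*} [TopologicalSpace X]

instance : PosSMulMono ℝ (X →ᵇ ℝ) where
  smul_le_smul_of_nonneg_left _ hc _ _ hfg x := mul_le_mul_of_nonneg_left (hfg x) hc

instance : ZeroLEOneClass (X →ᵇ ℝ) := ⟨fun _ => zero_le_one⟩

lemma le_norm_smul_one (f : X →ᵇ ℝ) : f ≤ ‖f‖ • 1 := fun x => by simpa using f.apply_le_norm x

lemma norm_le_of_nonneg_of_le_smul_one {f : X →ᵇ ℝ} {c : ℝ} (hc : 0 ≤ c) (hf : 0 ≤ f)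
    (hfc : f ≤ c • 1) : ‖f‖ ≤ c :=
  (BoundedContinuousFunction.norm_le hc).2 fun x => by
    simpa [abs_of_nonneg (show 0 ≤ f x from hf x)] using hfc x

lemma norm_one_le_one : ‖(1 : X →ᵇ ℝ)‖ ≤ 1 :=
  norm_le_of_nonneg_of_le_smul_one zero_le_one zero_le_one (one_smul ℝ 1).ge

lemma le_of_hasDerivAt_nonneg {u u' : ℝ → X →ᵇ ℝ} {a b : ℝ} (hab : a ≤ b)
    (hu : ∀ s, HasDerivAt u (u' s) s) (hu' : ∀ s ∈ Set.Icc a b, 0 ≤ u' s) : u a ≤ u b := by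
  intro x
  have hux : ∀ s, HasDerivAt (fun r => u r x) (u' s x) s := fun s =>
    (BoundedContinuousFunction.evalCLM ℝ x (α := X) (β := ℝ)).hasFDerivAt.comp_hasDerivAt s (hu s)
  exact monotoneOn_of_hasDerivWithinAt_nonneg (convex_Icc a b)
    (fun s _ => (hux s).continuousAt.continuousWithinAt)
    (fun s _ => (hux s).hasDerivWithinAt) (fun s hs => hu' s (interior_subset hs) x)
    (Set.left_mem_Icc.2 hab) (Set.right_mem_Icc.2 hab) hab

lemma apply_le_norm_smul_apply_one {R : (X →ᵇ ℝ) →L[ℝ] (X →ᵇ ℝ)} (hR : Monotone R) (h : X →ᵇ ℝ) :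
    R h ≤ ‖h‖ • R 1 := by
  simpa only [map_smul] using hR (le_norm_smul_one h)

lemma norm_apply_le_of_monotone {R : (X →ᵇ ℝ) →L[ℝ] (X →ᵇ ℝ)} (hR : Monotone R) (h : X →ᵇ ℝ) :
    ‖R h‖ ≤ ‖h‖ * ‖R 1‖ := by
  refine (BoundedContinuousFunction.norm_le (by positivity)).2 fun x => abs_le.2 ?_
  have hupper : R h x ≤ ‖h‖ * R 1 x := apply_le_norm_smul_apply_one hR h x
  have hlower : R (-h) x ≤ ‖-h‖ * R 1 x := apply_le_norm_smul_apply_one hR (-h) x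
  rw [map_neg, norm_neg, BoundedContinuousFunction.coe_neg, Pi.neg_apply] at hlower
  have hone := mul_le_mul_of_nonneg_left ((R 1).apply_le_norm x) (norm_nonneg h)
  exact ⟨by linarith, by linarith⟩

lemma norm_pow_apply_one_le {R : (X →ᵇ ℝ) →L[ℝ] (X →ᵇ ℝ)} (hR : Monotone R) (n : ℕ) :
    ‖(R ^ n) 1‖ ≤ ‖R 1‖ ^ n := by
  induction n with
  | zero => simpa using norm_one_le_one
  | succ n ih =>
    rw [pow_succ' R, pow_succ]
    exact (norm_apply_le_of_monotone hR _).trans (mul_le_mul_of_nonneg_right ih (norm_nonneg _))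

end Order

lemma monotone_opExp {F : Type*} [NormedAddCommGroup F] [NormedSpace ℝ F] [CompleteSpace F]
    [PartialOrder F] [IsOrderedAddMonoid F] [OrderClosedTopology F] [PosSMulMono ℝ F]
    {A : F →L[ℝ] F} {c : ℝ} (hA : Monotone fun g => A g + c • g) {t : ℝ} (ht : 0 ≤ t) :
    Monotone (opExp A t) := by
  let B := A + c • (1 : F →L[ℝ] F)
  have hB : Monotone B := hA
  have hshift : A = B + (-c) • (1 : F →L[ℝ] F) := by module
  rw [hshift, opExp_add_smul_one]
  refine fun g h hgh => smul_le_smul_of_nonneg_left ?_ (Real.exp_pos _).le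
  refine hasSum_le (fun n => smul_le_smul_of_nonneg_left ?_ (by positivity))
    (hasSum_opExp_apply _ t g) (hasSum_opExp_apply _ t h)
  simpa only [FunLike.coe_pow_eq_iterate] using hB.iterate n hgh

section Schrodinger

variable {R : Type*} [NormedCommRing R] [NormedAlgebra ℝ R]

/-- The Schrödinger operator `A + v`, whose semigroup is the Feynman–Kac semigroup with
potential `v`. -/
noncomputable def schrodinger (A : R →L[ℝ] R) (v : R) : R →L[ℝ] R :=
  A + ContinuousLinearMap.mul ℝ R v

@[simp] lemma schrodinger_apply (A : R →L[ℝ] R) (v h : R) : schrodinger A v h = A h + v * h := rfl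

lemma schrodinger_sub_smul_one (A : R →L[ℝ] R) (w : R) (c : ℝ) :
    schrodinger A (w - c • 1) = schrodinger A w + (-c) • 1 := by
  ext1 h
  simp only [schrodinger_apply, add_apply, smul_apply, one_apply_eq_self, sub_mul, smul_mul_assoc,
    one_mul]
  module

end Schrodinger

section MarkovGenerator

variable {X : Type*} [TopologicalSpace X]

/-- A bounded operator `A` on the bounded continuous functions generates a Markov semigroup if it
annihilates the constants and `A + c` is order preserving for some constant `c`, which for bounded
operators amounts to `A` satisfying the positive maximum principle. -/
structure IsMarkovGenerator (A : (X →ᵇ ℝ) →L[ℝ] (X →ᵇ ℝ)) : Prop where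
  apply_one : A 1 = 0
  exists_monotone : ∃ c : ℝ, Monotone fun g => A g + c • g

variable {A : (X →ᵇ ℝ) →L[ℝ] (X →ᵇ ℝ)}

namespace IsMarkovGenerator

lemma monotone_opExp_schrodinger (hA : IsMarkovGenerator A) (v : X →ᵇ ℝ) {t : ℝ} (ht : 0 ≤ t) :
    Monotone (opExp (schrodinger A v) t) := by
  obtain ⟨c, hc⟩ := hA.exists_monotone
  refine monotone_opExp (c := c + ‖v‖) (fun g h hgh x => ?_) ht
  have hv : 0 ≤ v x + ‖v‖ := by linarith [v.neg_norm_le_apply x]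
  have hmul : (v x + ‖v‖) * g x ≤ (v x + ‖v‖) * h x := mul_le_mul_of_nonneg_left (hgh x) hv
  have hAc : A g x + c * g x ≤ A h x + c * h x := hc hgh x
  change A g x + v x * g x + (c + ‖v‖) * g x ≤ A h x + v x * h x + (c + ‖v‖) * h x
  linarith

lemma monotone_opExp (hA : IsMarkovGenerator A) {t : ℝ} (ht : 0 ≤ t) : Monotone (opExp A t) :=
  let ⟨_, hc⟩ := hA.exists_monotone
  _root_.monotone_opExp hc ht

lemma opExp_apply_one (hA : IsMarkovGenerator A) (t : ℝ) : opExp A t 1 = 1 :=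
  opExp_apply_of_apply_eq_zero hA.apply_one t

lemma norm_opExp_apply_le (hA : IsMarkovGenerator A) {t : ℝ} (ht : 0 ≤ t) (h : X →ᵇ ℝ) :
    ‖opExp A t h‖ ≤ ‖h‖ := by
  have hcontr := norm_apply_le_of_monotone (hA.monotone_opExp ht) h
  rw [hA.opExp_apply_one] at hcontr
  exact hcontr.trans (mul_le_of_le_one_right (norm_nonneg h) norm_one_le_one)

lemma opExp_schrodinger_one_nonneg (hA : IsMarkovGenerator A) (v : X →ᵇ ℝ) {t : ℝ} (ht : 0 ≤ t) :
    0 ≤ opExp (schrodinger A v) t 1 := by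
  simpa using hA.monotone_opExp_schrodinger v ht (zero_le_one (α := X →ᵇ ℝ))

lemma opExp_schrodinger_one_mono (hA : IsMarkovGenerator A) {W : X →ᵇ ℝ} (hW : 0 ≤ W) {s t : ℝ}
    (hs : 0 ≤ s) (hst : s ≤ t) :
    opExp (schrodinger A W) s 1 ≤ opExp (schrodinger A W) t 1 := by
  refine le_of_hasDerivAt_nonneg hst
    (fun r => hasDerivAt_opExp_apply (schrodinger A W) (hasDerivAt_const r 1)) fun r hr => ?_
  simpa [hA.apply_one] using hA.monotone_opExp_schrodinger W (hs.trans hr.1) hW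

lemma norm_opExp_schrodinger_one_mono (hA : IsMarkovGenerator A) {W : X →ᵇ ℝ} (hW : 0 ≤ W)
    {s t : ℝ} (hs : 0 ≤ s) (hst : s ≤ t) :
    ‖opExp (schrodinger A W) s 1‖ ≤ ‖opExp (schrodinger A W) t 1‖ := by
  refine norm_le_norm_of_abs_le_abs ?_
  rw [abs_of_nonneg (hA.opExp_schrodinger_one_nonneg W hs),
    abs_of_nonneg (hA.opExp_schrodinger_one_nonneg W (hs.trans hst))]
  exact hA.opExp_schrodinger_one_mono hW hs hst

-- Khasminskii's argument: by Duhamel's formula the Feynman–Kac function of `W` exceeds `1` by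
-- `∫₀ᵀ P_s(W R_{T-s} 1) ds`, and `R_{T-s} 1 ≤ ‖R_T 1‖`.
lemma norm_opExp_schrodinger_one_le (hA : IsMarkovGenerator A) {W : X →ᵇ ℝ} (hW : 0 ≤ W) {T : ℝ}
    (hT : 0 ≤ T) :
    ‖opExp (schrodinger A W) T 1‖ ≤
      1 + ‖opExp (schrodinger A W) T 1‖ * ∫ s in 0..T, ‖opExp A s W‖ := by
  let P := opExp A
  let R := opExp (schrodinger A W)
  let β := ‖R T 1‖
  have hcont : Continuous fun s => ‖P s W‖ := ((continuous_opExp A).clm_apply continuous_const).norm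
  have hderiv : ∀ s, HasDerivAt
      (fun r => P r (R (T - r) 1) + (β * ∫ q in 0..r, ‖P q W‖) • (1 : X →ᵇ ℝ))
      (-P s (W * R (T - s) 1) + (β * ‖P s W‖) • 1) s := fun s => by
    have hP := hasDerivAt_opExp_apply A
      (hasDerivAt_opExp_sub_apply (schrodinger A W) (1 : X →ᵇ ℝ) T s)
    rw [schrodinger_apply, neg_add, add_neg_cancel_left, map_neg] at hP
    exact hP.add
      (((hcont.integral_hasStrictDerivAt 0 s).hasDerivAt.const_mul β).smul_const (1 : X →ᵇ ℝ))
  have hderiv_nonneg : ∀ s ∈ Set.Icc 0 T, 0 ≤ -P s (W * R (T - s) 1) + (β * ‖P s W‖) • 1 := by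
    intro s hs x
    have hRs : ‖R (T - s) 1‖ ≤ β :=
      hA.norm_opExp_schrodinger_one_mono hW (sub_nonneg.2 hs.2) (sub_le_self T hs.1)
    have hWR : W * R (T - s) 1 ≤ β • W := fun y => by
      simpa [mul_comm] using
        mul_le_mul_of_nonneg_left (((R (T - s) 1).apply_le_norm y).trans hRs) (hW y)
    have hPx : P s (W * R (T - s) 1) x ≤ β * P s W x := by
      simpa using hA.monotone_opExp hs.1 hWR x
    have hnorm := mul_le_mul_of_nonneg_left ((P s W).apply_le_norm x) (norm_nonneg (R T 1))
    simpa using hPx.trans hnorm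
  have hmono := le_of_hasDerivAt_nonneg hT hderiv hderiv_nonneg
  have hint : 0 ≤ ∫ s in 0..T, ‖P s W‖ :=
    intervalIntegral.integral_nonneg hT fun s _ => norm_nonneg (P s W)
  refine norm_le_of_nonneg_of_le_smul_one (by positivity)
    (hA.opExp_schrodinger_one_nonneg W hT) ?_
  simpa [P, R, β, hA.opExp_apply_one, add_smul] using hmono

lemma norm_opExp_schrodinger_one_le_mul_exp (hA : IsMarkovGenerator A) {W : X →ᵇ ℝ} (hW : 0 ≤ W)
    {M ω T : ℝ} (hT : 0 < T) (hω : 0 ≤ ω) (hM : ‖opExp (schrodinger A W) T 1‖ ≤ M)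
    (hTω : ‖opExp (schrodinger A W) T 1‖ ≤ Real.exp (ω * T)) {t : ℝ} (ht : 0 ≤ t) :
    ‖opExp (schrodinger A W) t 1‖ ≤ M * Real.exp (ω * t) := by
  let R := opExp (schrodinger A W)
  let n := ⌊t / T⌋₊
  have hnt : n * T ≤ t := (le_div_iff₀ hT).1 (Nat.floor_le (by positivity))
  have htn : t ≤ (n + 1 : ℕ) * T := by
    push_cast
    exact (div_le_iff₀ hT).1 (Nat.lt_floor_add_one (t / T)).le
  calc ‖R t 1‖ ≤ ‖R ((n + 1 : ℕ) * T) 1‖ := hA.norm_opExp_schrodinger_one_mono hW ht htn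
    _ = ‖(R T ^ (n + 1)) 1‖ := by rw [← opExp_natCast_mul]
    _ ≤ ‖R T 1‖ ^ (n + 1) :=
        norm_pow_apply_one_le (hA.monotone_opExp_schrodinger W hT.le) (n + 1)
    _ = ‖R T 1‖ * ‖R T 1‖ ^ n := pow_succ' _ _
    _ ≤ M * Real.exp (ω * T) ^ n := by gcongr; exact (norm_nonneg _).trans hM
    _ = M * Real.exp (ω * (n * T)) := by rw [← Real.exp_nat_mul]; congr 2; ring
    _ ≤ M * Real.exp (ω * t) := by gcongr; exact (norm_nonneg _).trans hM

lemma opExp_schrodinger_one_le_exp_neg (hA : IsMarkovGenerator A) {K T : ℝ} (hK : 0 < K)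
    (hT : 0 < T) {W : X →ᵇ ℝ} (hW : 0 ≤ W)
    (hkato : ∫ s in 0..T, ‖opExp A s W‖ ≤ 1 / 4 * (1 - Real.exp (-(K * T / 2)))) {t : ℝ}
    (ht : 0 ≤ t) :
    opExp (schrodinger A ((2 : ℝ) • W - (2 * K) • 1)) t 1 ≤ (2 * Real.exp (-(K * t))) • 1 := by
  have hW₂ : 0 ≤ (2 : ℝ) • W := smul_nonneg zero_le_two hW
  let R := opExp (schrodinger A ((2 : ℝ) • W))
  have hkhas : ‖R T 1‖ ≤ 1 + ‖R T 1‖ * (2 * ∫ s in 0..T, ‖opExp A s W‖) := by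
    simpa [norm_smul] using hA.norm_opExp_schrodinger_one_le hW₂ hT.le
  have hexp : Real.exp (-(K * T / 2)) * Real.exp (K / 2 * T) = 1 := by
    rw [← Real.exp_add, Real.exp_eq_one_iff]; ring
  have hone : 1 ≤ Real.exp (K / 2 * T) := Real.one_le_exp (by positivity)
  have hself : ‖R T 1‖ * (1 + Real.exp (-(K * T / 2))) ≤ 2 := by
    nlinarith [mul_le_mul_of_nonneg_left hkato (norm_nonneg (R T 1))]
  have hR_two : ‖R T 1‖ ≤ 2 :=
    (le_mul_of_one_le_right (norm_nonneg _) (le_add_of_nonneg_right (Real.exp_nonneg _))).trans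
      hself
  have hR_exp : ‖R T 1‖ ≤ Real.exp (K / 2 * T) := by nlinarith
  have hgrowth : ‖R t 1‖ ≤ 2 * Real.exp (K / 2 * t) :=
    hA.norm_opExp_schrodinger_one_le_mul_exp hW₂ hT (by positivity) hR_two hR_exp ht
  intro x
  have hRx : R t 1 x ≤ 2 * Real.exp (K * t) :=
    ((R t 1).apply_le_norm x).trans (hgrowth.trans (by gcongr; linarith))
  rw [schrodinger_sub_smul_one, opExp_add_smul_one]
  calc Real.exp (-(2 * K) * t) * R t 1 x
      ≤ Real.exp (-(2 * K) * t) * (2 * Real.exp (K * t)) := by gcongr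
    _ = 2 * Real.exp (-(K * t)) * 1 := by
      rw [mul_left_comm, ← Real.exp_add]; ring_nf

end IsMarkovGenerator

end MarkovGenerator

section CarreDuChamp

variable {R : Type*} [NormedCommRing R] [NormedAlgebra ℝ R]

/-- The carré du champ `Γ(f, g) = (A(fg) - f Ag - g Af) / 2` of an operator `A`. -/
noncomputable def carreDuChamp (A : R →L[ℝ] R) (f g : R) : R :=
  (1 / 2 : ℝ) • (A (f * g) - f * A g - g * A f)

/-- The iterated carré du champ `Γ₂(f, g) = (A Γ(f, g) - Γ(f, Ag) - Γ(g, Af)) / 2`. -/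
noncomputable def carreDuChamp₂ (A : R →L[ℝ] R) (f g : R) : R :=
  (1 / 2 : ℝ) • (A (carreDuChamp A f g) - carreDuChamp A f (A g) - carreDuChamp A g (A f))

variable (A : R →L[ℝ] R)

lemma carreDuChamp_neg_right (f g : R) : carreDuChamp A f (-g) = -carreDuChamp A f g := by
  simp only [carreDuChamp, mul_neg, neg_mul, map_neg]
  module

lemma apply_mul_self (f : R) :
    A (f * f) = (2 : ℝ) • (carreDuChamp A f f + f * A f) := by
  simp only [carreDuChamp]
  module

lemma apply_carreDuChamp_self (f : R) :
    A (carreDuChamp A f f) = (2 : ℝ) • (carreDuChamp₂ A f f + carreDuChamp A f (A f)) := by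
  simp only [carreDuChamp₂]
  module

variable {A} {u : ℝ → R} {s : ℝ}

lemma hasDerivAt_carreDuChamp_self {u' : R} (hu : HasDerivAt u u' s) :
    HasDerivAt (fun r => carreDuChamp A (u r) (u r)) ((2 : ℝ) • carreDuChamp A (u s) u') s := by
  have hA {w : ℝ → R} {w' : R} (hw : HasDerivAt w w' s) : HasDerivAt (fun r => A (w r)) (A w') s :=
    A.hasFDerivAt.comp_hasDerivAt s hw
  have huA := hu.mul (hA hu)
  have hderiv : (2 : ℝ) • carreDuChamp A (u s) u' =
      (1 / 2 : ℝ) • (A (u' * u s + u s * u') - (u' * A (u s) + u s * A u') -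
        (u' * A (u s) + u s * A u')) := by
    simp only [carreDuChamp, mul_comm u' (u s), map_add]
    module
  rw [hderiv]
  exact (((hA (hu.mul hu)).sub huA).sub huA).const_smul (1 / 2 : ℝ)

variable [CompleteSpace R]

-- The carré du champ term produces `Γ₂`, while the derivative of `2 (t - r)` cancels the `Γ` coming
-- from `A (u ^ 2)`.
lemma hasDerivAt_opExp_sq_add_carreDuChamp (v : R) (t : ℝ) (hu : HasDerivAt u (-A (u s)) s) :
    HasDerivAt (fun r => opExp (schrodinger A v) r
        (u r * u r + (2 * (t - r)) • carreDuChamp A (u r) (u r)))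
      (opExp (schrodinger A v) s (v * (u s * u s) + (2 * (t - s)) •
        (v * carreDuChamp A (u s) (u s) + (2 : ℝ) • carreDuChamp₂ A (u s) (u s)))) s := by
  have htime : HasDerivAt (fun r : ℝ => 2 * (t - r)) (-2) s := by
    simpa using ((hasDerivAt_id s).const_sub t).const_mul 2
  have hF : HasDerivAt
      (fun r => u r * u r + (2 * (t - r)) • carreDuChamp A (u r) (u r)) _ s :=
    (hu.mul hu).add (htime.smul (hasDerivAt_carreDuChamp_self (A := A) hu))
  refine (hasDerivAt_opExp_apply (schrodinger A v) hF).congr_deriv (congrArg _ ?_)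
  simp only [schrodinger_apply, map_add, map_smul, apply_mul_self A, apply_carreDuChamp_self A,
    carreDuChamp_neg_right, neg_mul, mul_comm (A (u s)), mul_neg]
  module

end CarreDuChamp

namespace IsMarkovGenerator

variable {X : Type*} [TopologicalSpace X] {A : (X →ᵇ ℝ) →L[ℝ] (X →ᵇ ℝ)}

lemma opExp_mul_self_le (hA : IsMarkovGenerator A) (g : X →ᵇ ℝ) {t : ℝ} (ht : 0 ≤ t) :
    opExp A t g * opExp A t g ≤ ‖g‖ ^ 2 • 1 := fun x => by
  have hx := ((opExp A t g).norm_coe_le_norm x).trans (hA.norm_opExp_apply_le ht g)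
  simpa [← sq] using pow_le_pow_left₀ (norm_nonneg _) hx 2

lemma opExp_mul_self_add_carreDuChamp_le (hA : IsMarkovGenerator A) {v : X →ᵇ ℝ} {K C : ℝ}
    (hK : 0 ≤ K)
    (hv : -(2 * K) • 1 ≤ v)
    (hcurv : ∀ u, 0 ≤ v * carreDuChamp A u u + (2 : ℝ) • carreDuChamp₂ A u u)
    (hdecay : ∀ s, 0 ≤ s → opExp (schrodinger A v) s 1 ≤ (C * Real.exp (-(K * s))) • 1)
    (g : X →ᵇ ℝ) {t : ℝ} (ht : 0 ≤ t) :
    opExp A t g * opExp A t g + (2 * t) • carreDuChamp A (opExp A t g) (opExp A t g) ≤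
      opExp (schrodinger A v) t (g * g) + (2 * C * ‖g‖ ^ 2 * (1 - Real.exp (-(K * t)))) • 1 := by
  let u (s : ℝ) := opExp A (t - s) g
  let Q := opExp (schrodinger A v)
  let Φ (s : ℝ) := v * (u s * u s) + (2 * (t - s)) •
    (v * carreDuChamp A (u s) (u s) + (2 : ℝ) • carreDuChamp₂ A (u s) (u s))
  have hQ : ∀ s, 0 ≤ s → ∀ x, ‖g‖ ^ 2 * Q s 1 x ≤ ‖g‖ ^ 2 * (C * Real.exp (-(K * s))) :=
    fun s hs x => mul_le_mul_of_nonneg_left (by simpa using hdecay s hs x) (sq_nonneg ‖g‖)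
  have hΦ : ∀ s ≤ t, (-(2 * K * ‖g‖ ^ 2)) • 1 ≤ Φ s := fun s hs => by
    have hcurvs := smul_nonneg (mul_nonneg zero_le_two (sub_nonneg.2 hs)) (hcurv (u s))
    refine le_add_of_le_of_nonneg (fun x => ?_) hcurvs
    have hvx : -(2 * K) ≤ v x := by simpa using hv x
    have hux : u s x * u s x ≤ ‖g‖ ^ 2 := by simpa using hA.opExp_mul_self_le g (sub_nonneg.2 hs) x
    have hvux := mul_le_mul_of_nonneg_right hvx (mul_self_nonneg (u s x))
    have hKux := mul_le_mul_of_nonneg_left hux hK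
    change -(2 * K * ‖g‖ ^ 2) * 1 ≤ v x * (u s x * u s x)
    linarith
  have hexp : ∀ s, HasDerivAt (fun r => (2 * C * ‖g‖ ^ 2 * Real.exp (-(K * r))) • (1 : X →ᵇ ℝ))
      ((2 * C * ‖g‖ ^ 2 * (Real.exp (-(K * s)) * -(K * 1))) • 1) s := fun s =>
    ((((hasDerivAt_id s).const_mul K).neg.exp).const_mul _).smul_const (1 : X →ᵇ ℝ)
  have hmono := le_of_hasDerivAt_nonneg ht (fun s => (hasDerivAt_opExp_sq_add_carreDuChamp v t
    (hasDerivAt_opExp_sub_apply A g t s)).sub (hexp s)) fun s hs x => ?_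
  · intro x
    have hx : u 0 x * u 0 x + 2 * t * carreDuChamp A (u 0) (u 0) x - 2 * C * ‖g‖ ^ 2 ≤
        Q t (g * g) x - 2 * C * ‖g‖ ^ 2 * Real.exp (-(K * t)) := by
      simpa [Q, u] using hmono x
    have hx' : u 0 x * u 0 x + 2 * t * carreDuChamp A (u 0) (u 0) x ≤
        Q t (g * g) x + 2 * C * ‖g‖ ^ 2 * (1 - Real.exp (-(K * t))) * 1 := by linarith
    simpa [u] using hx'
  · have hQΦ : -(2 * K * ‖g‖ ^ 2) * Q s 1 x ≤ Q s (Φ s) x := by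
      simpa using hA.monotone_opExp_schrodinger v hs.1 (hΦ s hs.2) x
    have hQx := mul_le_mul_of_nonneg_left (hQ s hs.1 x) hK
    change 0 ≤ Q s (Φ s) x - 2 * C * ‖g‖ ^ 2 * (Real.exp (-(K * s)) * -(K * 1)) * 1
    linarith

lemma smul_carreDuChamp_opExp_le (hA : IsMarkovGenerator A) {v : X →ᵇ ℝ} {K C : ℝ} (hK : 0 ≤ K)
    (hv : -(2 * K) • 1 ≤ v)
    (hcurv : ∀ u, 0 ≤ v * carreDuChamp A u u + (2 : ℝ) • carreDuChamp₂ A u u)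
    (hdecay : ∀ s, 0 ≤ s → opExp (schrodinger A v) s 1 ≤ (C * Real.exp (-(K * s))) • 1)
    (g : X →ᵇ ℝ) {t : ℝ} (ht : 0 ≤ t) :
    t • carreDuChamp A (opExp A t g) (opExp A t g) ≤ (C * ‖g‖ ^ 2) • 1 := by
  let u := opExp A t g
  let Q := opExp (schrodinger A v) t
  have hQ_mono : Monotone Q := hA.monotone_opExp_schrodinger v ht
  have hg : g * g ≤ ‖g‖ ^ 2 • 1 := by simpa using hA.opExp_mul_self_le g le_rfl
  intro x
  have hQg : Q (g * g) x ≤ ‖g‖ ^ 2 * Q 1 x := by simpa using hQ_mono hg x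
  have hQ_nonneg : 0 ≤ ‖g‖ ^ 2 * Q 1 x :=
    mul_nonneg (sq_nonneg _) (hA.opExp_schrodinger_one_nonneg v ht x)
  have hQ_decay : ‖g‖ ^ 2 * Q 1 x ≤ ‖g‖ ^ 2 * (C * Real.exp (-(K * t))) :=
    mul_le_mul_of_nonneg_left (by simpa using hdecay t ht x) (sq_nonneg ‖g‖)
  have hflow : u x * u x + 2 * t * carreDuChamp A u u x ≤
      Q (g * g) x + 2 * C * ‖g‖ ^ 2 * (1 - Real.exp (-(K * t))) := by
    simpa using hA.opExp_mul_self_add_carreDuChamp_le hK hv hcurv hdecay g ht x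
  change t * carreDuChamp A u u x ≤ C * ‖g‖ ^ 2 * 1
  linarith [mul_self_nonneg (u x)]

end IsMarkovGenerator

namespace MWGraph

section LocalCalculus

variable {V : Type*} (G : MWGraph V)

lemma deg_nonneg (x : V) : 0 ≤ G.deg x := Finset.sum_nonneg fun y _ => G.q_nonneg x y

lemma q_mul_inv_comm (x y : V) : G.q x y * (G.m y)⁻¹ = G.q y x * (G.m x)⁻¹ := by
  simp only [q, G.w_symm x y, div_eq_mul_inv]
  ring

lemma hasSum_q_mul (x : V) (a : V → ℝ) :
    HasSum (fun y => G.q x y * a y) (∑ y ∈ G.nbrs x, G.q x y * a y) := by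
  refine hasSum_sum_of_ne_finset_zero fun y hy => ?_
  have hw : G.w x y = 0 := (not_lt.1 (G.mem_nbrs.not.1 hy)).antisymm (G.w_nonneg x y)
  simp [q, hw]

lemma lap_eq_sum_sub_deg_mul (f : V → ℝ) (x : V) :
    G.lap f x = ∑ y ∈ G.nbrs x, G.q x y * f y - G.deg x * f x := by
  simp only [lap, deg, Finset.sum_mul, mul_sub, Finset.sum_sub_distrib]

lemma lap_add (f g : V → ℝ) : G.lap (f + g) = G.lap f + G.lap g := by
  ext x
  simp only [lap_eq_sum_sub_deg_mul, Pi.add_apply, mul_add, Finset.sum_add_distrib]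
  ring

lemma lap_smul (c : ℝ) (f : V → ℝ) : G.lap (c • f) = c • G.lap f := by
  ext x
  simp only [lap_eq_sum_sub_deg_mul, Pi.smul_apply, smul_eq_mul, mul_left_comm _ c,
    ← Finset.mul_sum, mul_sub]

lemma lap_one : G.lap 1 = 0 := by
  ext x
  simp [lap]

lemma Gam_eq_sum (f g : V → ℝ) (x : V) :
    G.Gam f g x = 1 / 2 * ∑ y ∈ G.nbrs x, G.q x y * ((f y - f x) * (g y - g x)) := by
  simp only [Gam, lap, Pi.mul_apply, Finset.mul_sum, ← Finset.sum_sub_distrib]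
  exact Finset.sum_congr rfl fun y _ => by ring

lemma Gam_add_right (f g h : V → ℝ) (x : V) : G.Gam f (g + h) x = G.Gam f g x + G.Gam f h x := by
  simp only [Gam, mul_add, lap_add, Pi.add_apply]
  ring

lemma Gam_smul_right (c : ℝ) (f g : V → ℝ) (x : V) : G.Gam f (c • g) x = c * G.Gam f g x := by
  simp only [Gam, mul_smul_comm, lap_smul, Pi.smul_apply, smul_eq_mul]
  ring

lemma Gam_self_nonneg (f : V → ℝ) (x : V) : 0 ≤ G.Gam f f x := by
  rw [Gam_self]
  exact mul_nonneg one_half_pos.le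
    (Finset.sum_nonneg fun y _ => mul_nonneg (G.q_nonneg x y) (sq_nonneg _))

lemma abs_Gam_le (f g : V → ℝ) (x : V) :
    |G.Gam f g x| ≤ √(G.Gam f f x) * √(G.Gam g g x) := by
  rw [← Real.sqrt_mul (G.Gam_self_nonneg f x)]
  refine Real.abs_le_sqrt ?_
  have hCS := Finset.sum_sq_le_sum_mul_sum_of_sq_le_mul (G.nbrs x)
    (f := fun y => G.q x y * (f y - f x) ^ 2) (g := fun y => G.q x y * (g y - g x) ^ 2)
    (r := fun y => G.q x y * ((f y - f x) * (g y - g x)))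
    (fun y _ => mul_nonneg (G.q_nonneg x y) (sq_nonneg _))
    (fun y _ => mul_nonneg (G.q_nonneg x y) (sq_nonneg _)) (fun y _ => le_of_eq (by ring))
  rw [Gam_eq_sum, Gam_self, Gam_self]
  linarith

variable {G} {D : ℝ} (hD : ∀ x, G.deg x ≤ D)

include hD

lemma sum_q_mul_le {x : V} {a : V → ℝ} {C : ℝ} (hC : 0 ≤ C) (ha : ∀ y, a y ≤ C) :
    ∑ y ∈ G.nbrs x, G.q x y * a y ≤ D * C := by
  calc ∑ y ∈ G.nbrs x, G.q x y * a y ≤ ∑ y ∈ G.nbrs x, G.q x y * C :=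
        Finset.sum_le_sum fun y _ => mul_le_mul_of_nonneg_left (ha y) (G.q_nonneg x y)
    _ = G.deg x * C := by rw [deg, Finset.sum_mul]
    _ ≤ D * C := mul_le_mul_of_nonneg_right (hD x) hC

lemma abs_lap_le_of_bounded {f : V → ℝ} {C : ℝ} (hC : ∀ x, |f x| ≤ C) (x : V) :
    |G.lap f x| ≤ D * (2 * C) :=
  (G.abs_lap_le f x).trans <| sum_q_mul_le hD (by linarith [hC x, abs_nonneg (f x)]) fun y => by
    linarith [abs_sub (f y) (f x), hC x, hC y]

lemma Gam_self_le_of_bounded {f : V → ℝ} {C : ℝ} (hC : ∀ x, |f x| ≤ C) (x : V) :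
    G.Gam f f x ≤ D * (2 * C ^ 2) := by
  have hsum := sum_q_mul_le hD (x := x) (sq_nonneg (2 * C)) fun y =>
    sq_le_sq.2 ((show |f y - f x| ≤ 2 * C by
      linarith [abs_sub (f y) (f x), hC x, hC y]).trans (le_abs_self _))
  rw [Gam_self]
  linarith

lemma sqrt_Gam_self_le_of_bounded {h : V → ℝ} {C : ℝ} (hC : ∀ x, |h x| ≤ C) (x : V) :
    √(G.Gam h h x) ≤ √(2 * D) * C := by
  have hC₀ : 0 ≤ C := (abs_nonneg _).trans (hC x)
  rw [← Real.sqrt_sq hC₀, ← Real.sqrt_mul' _ (sq_nonneg C)]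
  exact Real.sqrt_le_sqrt ((Gam_self_le_of_bounded hD hC x).trans_eq (by ring))

lemma sq_lap_le (f : V → ℝ) (x : V) : G.lap f x ^ 2 ≤ 2 * D * G.Gam f f x := by
  have hD₀ : 0 ≤ 2 * D := by linarith [G.deg_nonneg x, hD x]
  have hsq := sq_le_sq' (abs_le.1 (G.abs_lap_le_sqrt_Gam hD f x)).1
    (abs_le.1 (G.abs_lap_le_sqrt_Gam hD f x)).2
  rwa [mul_pow, Real.sq_sqrt hD₀, Real.sq_sqrt (G.Gam_self_nonneg f x)] at hsq

end LocalCalculus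

section Curvature

variable {V : Type*} {G : MWGraph V} {ρ : V → ℝ}

variable (G) in
lemma two_mul_Gam2_self (f : V → ℝ) (x : V) :
    2 * G.Gam2 f f x = ∑ y ∈ G.nbrs x, G.q x y *
      (G.Gam f f y - G.Gam f f x - (f y - f x) * (G.lap f y - G.lap f x)) := by
  simp only [mul_sub (G.q x _) (_ - _), Finset.sum_sub_distrib]
  rw [Gam2, Gam_eq_sum G f (G.lap f), lap]
  ring

lemma CD_top_iff : G.CD ρ ⊤ ↔
    ∀ f : V → ℝ, (∃ C, ∀ x, |f x| ≤ C) → ∀ x, ρ x * G.Gam f f x ≤ G.Gam2 f f x := by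
  simp [CD]

lemma CD_neg_of_deg_le {D : ℝ} (hD : ∀ x, G.deg x ≤ D) : G.CD (fun _ => -D) ⊤ := by
  rw [CD_top_iff]
  intro f _ x
  -- AM-GM together with `(Δf y)² ≤ 2D Γf(y)` absorbs the only term of `Γ₂` that is not local at `x`
  have hy : ∀ y, (f y - f x) * G.lap f y ≤ D / 2 * (f y - f x) ^ 2 + G.Gam f f y := fun y => by
    have hD₀ : 0 ≤ D := (G.deg_nonneg y).trans (hD y)
    have hamgm := two_mul_le_add_of_sq_le_mul (r := (f y - f x) * G.lap f y / 2)
      (mul_nonneg (half_pos two_pos).le (by positivity : 0 ≤ D / 2 * (f y - f x) ^ 2))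
      (G.Gam_self_nonneg f y) (by nlinarith [sq_lap_le hD f y, sq_nonneg (f y - f x)])
    linarith
  have hlocal : G.lap f x ^ 2 - D * G.Gam f f x - G.deg x * G.Gam f f x ≤ 2 * G.Gam2 f f x := by
    calc G.lap f x ^ 2 - D * G.Gam f f x - G.deg x * G.Gam f f x
        = ∑ y ∈ G.nbrs x, G.q x y * (f y - f x) * G.lap f x
          - D / 2 * ∑ y ∈ G.nbrs x, G.q x y * (f y - f x) ^ 2
          - ∑ y ∈ G.nbrs x, G.q x y * G.Gam f f x := by
          rw [← Finset.sum_mul, ← Finset.sum_mul, Gam_self, lap, deg]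
          ring
      _ = ∑ y ∈ G.nbrs x, G.q x y *
            ((f y - f x) * G.lap f x - D / 2 * (f y - f x) ^ 2 - G.Gam f f x) := by
          rw [Finset.mul_sum, ← Finset.sum_sub_distrib, ← Finset.sum_sub_distrib]
          exact Finset.sum_congr rfl fun y _ => by ring
      _ ≤ 2 * G.Gam2 f f x := by
          rw [two_mul_Gam2_self]
          exact Finset.sum_le_sum fun y _ =>
            mul_le_mul_of_nonneg_left (by linarith [hy y]) (G.q_nonneg x y)
  linarith [sq_nonneg (G.lap f x), mul_le_mul_of_nonneg_right (hD x) (G.Gam_self_nonneg f x)]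

lemma CD.mono {ρ' : V → ℝ} {n : ℝ≥0∞} (h : G.CD ρ n) (hρ : ρ' ≤ ρ) : G.CD ρ' n := fun f hf x =>
  (add_le_add_left (mul_le_mul_of_nonneg_right (hρ x) (G.Gam_self_nonneg f x)) _).trans (h f hf x)

lemma CD.sup {ρ' : V → ℝ} {n : ℝ≥0∞} (h : G.CD ρ n) (h' : G.CD ρ' n) : G.CD (ρ ⊔ ρ') n :=
  fun f hf x => by
    rcases max_choice (ρ x) (ρ' x) with hmax | hmax
    · simpa only [Pi.sup_apply, hmax] using h f hf x
    · simpa only [Pi.sup_apply, hmax] using h' f hf x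

lemma CD.sub_min_negPart {D K n : ℝ} (h : G.CD ρ ⊤) (hD : ∀ x, G.deg x ≤ D) (hn : K + D ≤ n) :
    G.CD (fun x => K - min n (ρ x - K)⁻) ⊤ := by
  refine (h.sup (CD_neg_of_deg_le hD)).mono fun x => ?_
  rcases min_choice n (ρ x - K)⁻ with hmin | hmin <;> simp only [hmin]
  · exact le_sup_of_le_right (by linarith)
  · exact le_sup_of_le_left (by linarith [neg_le_negPart (ρ x - K)])

end Curvature

section BoundedLap

variable {V : Type*} [TopologicalSpace V] [DiscreteTopology V] {G : MWGraph V} {D : ℝ}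
  (hD : ∀ x, G.deg x ≤ D)

/-- The Laplacian of a graph of bounded degree as a bounded operator on `ℓ^∞(V)`, the latter being
encoded as the bounded continuous functions for the discrete topology. -/
noncomputable def boundedLap : (V →ᵇ ℝ) →L[ℝ] (V →ᵇ ℝ) :=
  LinearMap.mkContinuous
    { toFun := fun h => BoundedContinuousFunction.ofNormedAddCommGroupDiscrete (G.lap h) _
        (abs_lap_le_of_bounded hD h.norm_coe_le_norm)
      map_add' := fun f g => BoundedContinuousFunction.ext (congrFun (G.lap_add f g))
      map_smul' := fun c f => BoundedContinuousFunction.ext (congrFun (G.lap_smul c f)) }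
    (|D| * 2) fun h => (BoundedContinuousFunction.norm_le (by positivity)).2 fun x =>
      (abs_lap_le_of_bounded hD h.norm_coe_le_norm x).trans <| by
        rw [mul_assoc]
        gcongr
        exact le_abs_self D

lemma coe_boundedLap (h : V →ᵇ ℝ) : ⇑(boundedLap hD h) = G.lap h := rfl

lemma coe_carreDuChamp_boundedLap (f g : V →ᵇ ℝ) :
    ⇑(carreDuChamp (boundedLap hD) f g) = G.Gam f g := rfl

lemma isMarkovGenerator_boundedLap : IsMarkovGenerator (boundedLap hD) where
  apply_one := BoundedContinuousFunction.ext (congrFun G.lap_one)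
  exists_monotone := ⟨D, fun g h hgh x => by
    have hsum : ∑ y ∈ G.nbrs x, G.q x y * g y ≤ ∑ y ∈ G.nbrs x, G.q x y * h y :=
      Finset.sum_le_sum fun y _ => mul_le_mul_of_nonneg_left (hgh y) (G.q_nonneg x y)
    have hx : (D - G.deg x) * g x ≤ (D - G.deg x) * h x :=
      mul_le_mul_of_nonneg_left (hgh x) (sub_nonneg.2 (hD x))
    change G.lap g x + D * g x ≤ G.lap h x + D * h x
    rw [lap_eq_sum_sub_deg_mul, lap_eq_sum_sub_deg_mul]
    linarith⟩

lemma coe_boundedLap_pow (n : ℕ) (h : V →ᵇ ℝ) : ⇑((boundedLap hD ^ n) h) = G.lap^[n] h := by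
  induction n with
  | zero => rfl
  | succ n ih => rw [pow_succ', Function.iterate_succ_apply', ← ih]; rfl

lemma coe_opExp_boundedLap (t : ℝ) (h : V →ᵇ ℝ) : ⇑(opExp (boundedLap hD) t h) = G.heat t h := by
  ext x
  have hsum := (hasSum_opExp_apply (boundedLap hD) t h).mapL
    (BoundedContinuousFunction.evalCLM ℝ x (α := V) (β := ℝ))
  simp only [map_smul, BoundedContinuousFunction.evalCLM_apply, coe_boundedLap_pow,
    smul_eq_mul] at hsum
  exact hsum.tsum_eq.symm

end BoundedLap

section GradientEstimate

variable {V : Type*} [TopologicalSpace V]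

lemma ofReal_norm_le_supNorm (h : V →ᵇ ℝ) : ENNReal.ofReal ‖h‖ ≤ supNorm h := by
  by_cases htop : supNorm h = ∞
  · exact htop ▸ le_top
  · refine ENNReal.ofReal_le_of_le_toReal
      ((BoundedContinuousFunction.norm_le ENNReal.toReal_nonneg).2 fun x => ?_)
    exact (ENNReal.ofReal_le_iff_le_toReal htop).1 (le_iSup (fun x => ENNReal.ofReal |h x|) x)

variable [DiscreteTopology V] {G : MWGraph V} {D : ℝ} (hD : ∀ x, G.deg x ≤ D)

lemma ofReal_integral_norm_opExp_le_kato {T : ℝ} (hT : 0 ≤ T) {w : V → ℝ} {W : V →ᵇ ℝ} {n : ℕ}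
    (hW : ⇑W = fun x => min (n : ℝ) (w x)) :
    ENNReal.ofReal (∫ s in 0..T, ‖opExp (boundedLap hD) s W‖) ≤ G.kato T w := by
  have hcont : Continuous fun s => ‖opExp (boundedLap hD) s W‖ :=
    ((continuous_opExp (boundedLap hD)).clm_apply continuous_const).norm
  rw [intervalIntegral.integral_of_le hT, MeasureTheory.ofReal_integral_eq_lintegral_ofReal
    hcont.integrableOn_Ioc (.of_forall fun _ => norm_nonneg _)]
  refine le_trans (MeasureTheory.lintegral_mono fun s => ?_) (le_iSup (fun n : ℕ =>
    ∫⁻ t in Set.Ioc 0 T, supNorm (G.heat t fun x => min (n : ℝ) (w x))) n)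
  simpa only [coe_opExp_boundedLap, hW] using ofReal_norm_le_supNorm (opExp (boundedLap hD) s W)

lemma smul_carreDuChamp_opExp_boundedLap_le {K T : ℝ} (hK : 0 < K) (hT : 0 < T) {ρ : V → ℝ}
    (hCD : G.CD ρ ⊤)
    (hkato : G.kato T (fun x => (ρ x - K)⁻) ≤
      ENNReal.ofReal (1 / 4 * (1 - Real.exp (-(K * T / 2))))) (g : V →ᵇ ℝ) {t : ℝ} (ht : 0 ≤ t) :
    t • carreDuChamp (boundedLap hD) (opExp (boundedLap hD) t g) (opExp (boundedLap hD) t g) ≤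
      (2 * ‖g‖ ^ 2) • 1 := by
  have hA := isMarkovGenerator_boundedLap hD
  obtain ⟨n, hn⟩ := exists_nat_ge (K + D)
  have htrunc : ∀ x, 0 ≤ min (n : ℝ) (ρ x - K)⁻ := fun x =>
    le_min n.cast_nonneg (negPart_nonneg _)
  let W : V →ᵇ ℝ := .ofNormedAddCommGroupDiscrete (fun x => min (n : ℝ) (ρ x - K)⁻) n fun x => by
    simpa only [Real.norm_eq_abs, abs_of_nonneg (htrunc x)] using min_le_left _ _
  have hW : 0 ≤ W := htrunc
  have hkatoW : ∫ s in 0..T, ‖opExp (boundedLap hD) s W‖ ≤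
      1 / 4 * (1 - Real.exp (-(K * T / 2))) := by
    refine (ENNReal.ofReal_le_ofReal_iff (mul_nonneg (by norm_num) (sub_nonneg.2 ?_))).1
      ((ofReal_integral_norm_opExp_le_kato hD hT.le rfl).trans hkato)
    exact Real.exp_le_one_iff.2 (neg_nonpos.2 (by positivity))
  refine hA.smul_carreDuChamp_opExp_le hK.le (v := (2 : ℝ) • W - (2 * K) • 1) (fun x => ?_)
    (fun u x => ?_) (fun s hs => hA.opExp_schrodinger_one_le_exp_neg hK hT hW hkatoW hs) g ht
  · change -(2 * K) * 1 ≤ 2 * W x - 2 * K * 1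
    linarith [hW x, show 0 ≤ W x from hW x]
  · have hcurv : (K - W x) * G.Gam u u x ≤ G.Gam2 u u x :=
      CD_top_iff.1 (hCD.sub_min_negPart hD hn) u ⟨_, u.norm_coe_le_norm⟩ x
    change 0 ≤ (2 * W x - 2 * K * 1) * G.Gam u u x + 2 * G.Gam2 u u x
    linarith

end GradientEstimate

section GradientPairing

variable {V : Type*} {G : MWGraph V} {f : V → ℝ}

lemma norm_mul_Gam_le {h : V → ℝ} {B : ℝ} {x : V} (hB : √(G.Gam h h x) ≤ B) :
    ‖G.m x * G.Gam f h x‖ ≤ G.m x * √(G.Gam f f x) * B := by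
  rw [Real.norm_eq_abs, abs_mul, abs_of_pos (G.m_pos x), mul_assoc]
  exact mul_le_mul_of_nonneg_left ((G.abs_Gam_le f h x).trans
    (mul_le_mul_of_nonneg_left hB (Real.sqrt_nonneg _))) (G.m_pos x).le

variable {D : ℝ} (hD : ∀ x, G.deg x ≤ D) (hf : G.norm1 (fun x => √(G.Gam f f x)) ≠ ∞)

include hf in
lemma hasSum_mul_sqrt_Gam :
    HasSum (fun x => G.m x * √(G.Gam f f x)) (G.norm1 fun x => √(G.Gam f f x)).toReal := by
  have hterm (x : V) : (ENNReal.ofReal (G.m x * |√(G.Gam f f x)|)).toReal =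
      G.m x * √(G.Gam f f x) := by
    rw [abs_of_nonneg (Real.sqrt_nonneg _),
      ENNReal.toReal_ofReal (mul_nonneg (G.m_pos x).le (Real.sqrt_nonneg _))]
  simpa only [norm1, ENNReal.tsum_toReal_eq fun _ => ENNReal.ofReal_ne_top, hterm] using
    ENNReal.hasSum_toReal hf

include hf in
lemma summable_mul_Gam {h : V → ℝ} {B : ℝ} (hB : ∀ x, √(G.Gam h h x) ≤ B) :
    Summable fun x => G.m x * G.Gam f h x :=
  .of_norm_bounded ((hasSum_mul_sqrt_Gam hf).summable.mul_right B) fun x => norm_mul_Gam_le (hB x)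

include hf in
lemma norm_tsum_mul_Gam_le {h : V → ℝ} {B : ℝ} (hB : ∀ x, √(G.Gam h h x) ≤ B) :
    ‖∑' x, G.m x * G.Gam f h x‖ ≤ (G.norm1 fun x => √(G.Gam f f x)).toReal * B :=
  tsum_of_norm_bounded ((hasSum_mul_sqrt_Gam hf).mul_right B) fun x => norm_mul_Gam_le (hB x)

variable [TopologicalSpace V]

/-- The functional `h ↦ -∑_x m(x) Γ(f, h)(x)`, which by Green's formula is the weak form of
`h ↦ ∑_x m(x) Δf(x) h(x)`. -/
noncomputable def gradientPairing : (V →ᵇ ℝ) →L[ℝ] ℝ :=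
  LinearMap.mkContinuous
    { toFun := fun h => -∑' x, G.m x * G.Gam f h x
      map_add' := fun g h => by
        have hsum (h : V →ᵇ ℝ) : Summable fun x => G.m x * G.Gam f h x :=
          summable_mul_Gam hf (sqrt_Gam_self_le_of_bounded hD h.norm_coe_le_norm)
        simp only [BoundedContinuousFunction.coe_add, Gam_add_right, mul_add,
          (hsum g).tsum_add (hsum h), neg_add]
      map_smul' := fun c h => by
        change -∑' x, G.m x * G.Gam f (c • ⇑h) x = c * -∑' x, G.m x * G.Gam f h x
        simp only [Gam_smul_right, mul_left_comm _ c, tsum_mul_left, mul_neg] }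
    ((G.norm1 fun x => √(G.Gam f f x)).toReal * √(2 * D)) fun h => by
      simpa only [LinearMap.coe_mk, AddHom.coe_mk, norm_neg, mul_assoc] using
        norm_tsum_mul_Gam_le hf (sqrt_Gam_self_le_of_bounded hD h.norm_coe_le_norm)

lemma gradientPairing_apply (h : V →ᵇ ℝ) :
    gradientPairing hD hf h = -∑' x, G.m x * G.Gam f h x := rfl

lemma norm_gradientPairing_le {h : V →ᵇ ℝ} {B : ℝ} (hB : ∀ x, √(G.Gam h h x) ≤ B) :
    ‖gradientPairing hD hf h‖ ≤ (G.norm1 fun x => √(G.Gam f f x)).toReal * B := by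
  rw [gradientPairing_apply, norm_neg]
  exact norm_tsum_mul_Gam_le hf hB

variable [DiscreteTopology V]

lemma norm_gradientPairing_opExp_le {C : ℝ} {g : V →ᵇ ℝ} {s : ℝ} (hs : 0 < s)
    (hgrad : s • carreDuChamp (boundedLap hD) (opExp (boundedLap hD) s g)
      (opExp (boundedLap hD) s g) ≤ (C * ‖g‖ ^ 2) • 1) :
    ‖gradientPairing hD hf (opExp (boundedLap hD) s g)‖ ≤
      (G.norm1 fun x => √(G.Gam f f x)).toReal * (√C * ‖g‖) * s ^ (-(1 / 2) : ℝ) := by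
  rw [mul_assoc]
  refine norm_gradientPairing_le hD hf fun x => ?_
  have hx : s * G.Gam (opExp (boundedLap hD) s g) (opExp (boundedLap hD) s g) x ≤
      C * ‖g‖ ^ 2 := by
    simpa [coe_carreDuChamp_boundedLap] using hgrad x
  rw [Real.rpow_neg hs.le, ← Real.sqrt_eq_rpow, ← div_eq_mul_inv, le_div_iff₀ (Real.sqrt_pos.2 hs),
    ← Real.sqrt_mul' _ hs.le, ← Real.sqrt_sq (norm_nonneg g), ← Real.sqrt_mul' _ (sq_nonneg _)]
  exact Real.sqrt_le_sqrt (by linarith)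

lemma norm_gradientPairing_comp_integral_opExp_le {C : ℝ}
    (hgrad : ∀ g s, 0 ≤ s → s • carreDuChamp (boundedLap hD) (opExp (boundedLap hD) s g)
      (opExp (boundedLap hD) s g) ≤ (C * ‖g‖ ^ 2) • 1) {t : ℝ} (ht : 0 ≤ t) :
    ‖(gradientPairing hD hf).comp (∫ s in 0..t, opExp (boundedLap hD) s)‖ ≤
      2 * √C * √t * (G.norm1 fun x => √(G.Gam f f x)).toReal := by
  refine ContinuousLinearMap.opNorm_le_bound _ (by positivity) fun g => ?_
  have hcont := continuous_opExp (boundedLap hD)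
  have hroot : ∫ s in 0..t, s ^ (-(1 / 2) : ℝ) = 2 * √t := by
    rw [integral_rpow (.inl (by norm_num)), Real.sqrt_eq_rpow]
    norm_num
    ring
  rw [ContinuousLinearMap.comp_apply,
    ContinuousLinearMap.intervalIntegral_apply (hcont.intervalIntegrable 0 t),
    ← ContinuousLinearMap.intervalIntegral_comp_comm _
      ((hcont.clm_apply continuous_const).intervalIntegrable 0 t)]
  calc ‖∫ s in 0..t, gradientPairing hD hf (opExp (boundedLap hD) s g)‖
      ≤ ∫ s in 0..t, (G.norm1 fun x => √(G.Gam f f x)).toReal * (√C * ‖g‖) * s ^ (-(1 / 2) : ℝ) :=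
        intervalIntegral.norm_integral_le_of_norm_le ht
          (.of_forall fun s hs => norm_gradientPairing_opExp_le hD hf hs.1 (hgrad g s hs.1.le))
          ((intervalIntegral.intervalIntegrable_rpow' (by norm_num)).const_mul _)
    _ = 2 * √C * √t * (G.norm1 fun x => √(G.Gam f f x)).toReal * ‖g‖ := by
        rw [intervalIntegral.integral_const_mul, hroot]
        ring

end GradientPairing

section Delta

variable {V : Type*} [TopologicalSpace V] [DiscreteTopology V] (G : MWGraph V)

/-- The Dirac mass `1_z / m(z)` at `z`, normalised so that `∑_x m(x) g(x) δ_z(x) = g(z)`. -/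
noncomputable def delta (z : V) : V →ᵇ ℝ :=
  (G.m z)⁻¹ • BoundedContinuousFunction.indicator {z} (isClopen_discrete _)

lemma delta_apply_self (z : V) : G.delta z z = (G.m z)⁻¹ := by simp [delta]

lemma delta_apply_of_ne {x z : V} (h : x ≠ z) : G.delta z x = 0 := by simp [delta, h]

lemma delta_apply_comm (x z : V) : G.delta z x = G.delta x z := by
  rcases eq_or_ne x z with rfl | h
  · rfl
  · rw [G.delta_apply_of_ne h, G.delta_apply_of_ne h.symm]

lemma sum_q_mul_delta (a : V → ℝ) (x z : V) :
    ∑ y ∈ G.nbrs x, G.q x y * (a y * G.delta z y) = G.q x z * (a z * (G.m z)⁻¹) := by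
  refine (G.hasSum_q_mul x fun y => a y * G.delta z y).unique ?_
  simpa only [delta_apply_self] using
    hasSum_single (f := fun y => G.q x y * (a y * G.delta z y)) z fun y hy => by
      rw [G.delta_apply_of_ne hy, mul_zero, mul_zero]

lemma mul_Gam_delta (f : V → ℝ) (x z : V) :
    G.m x * G.Gam f (G.delta z) x =
      1 / 2 * (G.q z x * (f z - f x)) - 1 / 2 * (G.m x * (G.lap f x * G.delta z x)) := by
  have hsplit : ∑ y ∈ G.nbrs x, G.q x y * ((f y - f x) * (G.delta z y - G.delta z x)) =
      ∑ y ∈ G.nbrs x, G.q x y * ((f y - f x) * G.delta z y) - G.lap f x * G.delta z x := by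
    rw [lap, Finset.sum_mul, ← Finset.sum_sub_distrib]
    exact Finset.sum_congr rfl fun y _ => by ring
  rw [Gam_eq_sum, hsplit, G.sum_q_mul_delta (fun y => f y - f x), mul_left_comm (G.q x z),
    q_mul_inv_comm]
  have hm := (G.m_pos x).ne'
  field_simp

lemma hasSum_mul_Gam_delta (f : V → ℝ) (z : V) :
    HasSum (fun x => G.m x * G.Gam f (G.delta z) x) (-G.lap f z) := by
  have hgrad : HasSum (fun x => G.q z x * (f z - f x)) (-G.lap f z) := by
    simpa only [← mul_neg, neg_sub, lap] using (G.hasSum_q_mul z fun x => f x - f z).neg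
  have hpoint : HasSum (fun x => G.m x * (G.lap f x * G.delta z x)) (G.lap f z) := by
    have hz : G.m z * (G.lap f z * G.delta z z) = G.lap f z := by
      rw [delta_apply_self, mul_left_comm, mul_inv_cancel₀ (G.m_pos z).ne', mul_one]
    simpa only [hz] using hasSum_single (f := fun x => G.m x * (G.lap f x * G.delta z x)) z
      fun x hx => by rw [G.delta_apply_of_ne hx, mul_zero, mul_zero]
  have hsum := (hgrad.mul_left (1 / 2)).sub (hpoint.mul_left (1 / 2))
  rw [show 1 / 2 * -G.lap f z - 1 / 2 * G.lap f z = -G.lap f z by ring] at hsum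
  simpa only [mul_Gam_delta] using hsum

lemma norm_sum_smul_delta_le (S : Finset V) {ε : V → ℝ} (hε : ∀ z, |ε z| ≤ 1) :
    ‖∑ z ∈ S, (ε z * G.m z) • G.delta z‖ ≤ 1 := by
  refine (BoundedContinuousFunction.norm_le zero_le_one).2 fun x => ?_
  rw [BoundedContinuousFunction.sum_apply]
  have hzero : ∀ z ∈ S, z ≠ x → ((ε z * G.m z) • G.delta z) x = 0 := fun z _ hz => by
    simp [G.delta_apply_of_ne hz.symm]
  by_cases hx : x ∈ S
  · rw [Finset.sum_eq_single_of_mem x hx hzero]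
    simpa [delta_apply_self, (G.m_pos x).ne'] using hε x
  · rw [Finset.sum_eq_zero fun z hz => hzero z hz (ne_of_mem_of_not_mem hz hx), norm_zero]
    exact zero_le_one

lemma norm1_apply_delta_le (Θ : (V →ᵇ ℝ) →L[ℝ] ℝ) :
    G.norm1 (fun z => Θ (G.delta z)) ≤ ENNReal.ofReal ‖Θ‖ := by
  rw [norm1, ENNReal.tsum_eq_iSup_sum]
  refine iSup_le fun S => ?_
  rw [← ENNReal.ofReal_sum_of_nonneg fun z _ => mul_nonneg (G.m_pos z).le (abs_nonneg _)]
  refine ENNReal.ofReal_le_ofReal ?_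
  let ε (z : V) : ℝ := SignType.sign (Θ (G.delta z))
  have hε : ∀ z, |ε z| ≤ 1 := fun z => by
    rcases lt_trichotomy (Θ (G.delta z)) 0 with h | h | h <;> simp [ε, h]
  calc ∑ z ∈ S, G.m z * |Θ (G.delta z)| = Θ (∑ z ∈ S, (ε z * G.m z) • G.delta z) := by
        rw [map_sum]
        refine Finset.sum_congr rfl fun z _ => ?_
        rw [map_smul, smul_eq_mul, ← sign_mul_self]
        ring
    _ ≤ ‖Θ‖ * ‖∑ z ∈ S, (ε z * G.m z) • G.delta z‖ := (le_abs_self _).trans (Θ.le_opNorm _)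
    _ ≤ ‖Θ‖ := mul_le_of_le_one_right (norm_nonneg Θ) (G.norm_sum_smul_delta_le S hε)

variable {G} {D : ℝ} (hD : ∀ x, G.deg x ≤ D)

lemma gradientPairing_delta {f : V → ℝ} (hf : G.norm1 (fun x => √(G.Gam f f x)) ≠ ∞) (z : V) :
    gradientPairing hD hf (G.delta z) = G.lap f z := by
  rw [gradientPairing_apply, (G.hasSum_mul_Gam_delta f z).tsum_eq, neg_neg]

lemma boundedLap_delta (z : V) :
    boundedLap hD (G.delta z) = ∑ y ∈ G.nbrs z, G.q z y • (G.delta y - G.delta z) := by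
  ext x
  have hsum (x z : V) : ∑ y ∈ G.nbrs x, G.q x y * G.delta z y = G.q x z * (G.m z)⁻¹ := by
    simpa using G.sum_q_mul_delta 1 x z
  have hdeg : G.deg x * G.delta z x = G.deg z * G.delta z x := by
    rcases eq_or_ne x z with rfl | h
    · rfl
    · simp only [G.delta_apply_of_ne h, mul_zero]
  rw [coe_boundedLap, lap_eq_sum_sub_deg_mul, hsum, q_mul_inv_comm, hdeg, ← hsum z x,
    BoundedContinuousFunction.sum_apply, deg, Finset.sum_mul, ← Finset.sum_sub_distrib]
  refine Finset.sum_congr rfl fun y _ => ?_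
  rw [G.delta_apply_comm y x]
  exact (mul_sub _ _ _).symm

lemma apply_boundedLap_pow_delta (Λ : (V →ᵇ ℝ) →L[ℝ] ℝ) (n : ℕ) (z : V) :
    Λ ((boundedLap hD ^ n) (G.delta z)) = G.lap^[n] (fun y => Λ (G.delta y)) z := by
  induction n generalizing z with
  | zero => rfl
  | succ n ih =>
    rw [pow_succ, mul_apply_eq_comp, boundedLap_delta, Function.iterate_succ_apply']
    simp only [map_sum, map_smul, map_sub, ih, smul_eq_mul, lap]

lemma heat_sub_self_eq {f : V → ℝ} {Λ : (V →ᵇ ℝ) →L[ℝ] ℝ} (hΛ : ∀ z, Λ (G.delta z) = G.lap f z)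
    (t : ℝ) (z : V) :
    G.heat t f z - f z = Λ.comp (∫ s in 0..t, opExp (boundedLap hD) s) (G.delta z) := by
  have hsum := (hasSum_integral_opExp_apply (boundedLap hD) t (G.delta z)).mapL Λ
  simp only [map_smul, smul_eq_mul, apply_boundedLap_pow_delta, hΛ,
    ← Function.iterate_succ_apply G.lap] at hsum
  rw [hasSum_nat_add_iff (f := fun n => t ^ n / n ! * G.lap^[n] f z) 1] at hsum
  rw [heat, hsum.tsum_eq]
  simp

end Delta

section PseudoPoincare

variable {V : Type*} {G : MWGraph V}

lemma heat_zero (f : V → ℝ) : G.heat 0 f = f := by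
  ext x
  rw [heat, tsum_eq_single 0 fun n hn => by simp [hn]]
  simp

lemma norm1_sub_heat_le [TopologicalSpace V] [DiscreteTopology V] {D : ℝ} (hD : ∀ x, G.deg x ≤ D)
    {C : ℝ} (hgrad : ∀ g s, 0 ≤ s → s • carreDuChamp (boundedLap hD) (opExp (boundedLap hD) s g)
      (opExp (boundedLap hD) s g) ≤ (C * ‖g‖ ^ 2) • 1) {f : V → ℝ}
    (hf : G.norm1 (fun x => √(G.Gam f f x)) ≠ ∞) {t : ℝ} (ht : 0 ≤ t) :
    G.norm1 (fun x => f x - G.heat t f x) ≤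
      ENNReal.ofReal (2 * √C * √t) * G.norm1 (fun x => √(G.Gam f f x)) := by
  let Θ := (gradientPairing hD hf).comp (∫ s in 0..t, opExp (boundedLap hD) s)
  calc G.norm1 (fun x => f x - G.heat t f x) = G.norm1 fun x => Θ (G.delta x) := by
        simp only [norm1, abs_sub_comm (f _), Θ,
          heat_sub_self_eq hD (gradientPairing_delta hD hf)]
    _ ≤ ENNReal.ofReal ‖Θ‖ := G.norm1_apply_delta_le Θ
    _ ≤ ENNReal.ofReal (2 * √C * √t * (G.norm1 fun x => √(G.Gam f f x)).toReal) :=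
        ENNReal.ofReal_le_ofReal (norm_gradientPairing_comp_integral_opExp_le hD hf hgrad ht)
    _ = ENNReal.ofReal (2 * √C * √t) * G.norm1 (fun x => √(G.Gam f f x)) := by
        rw [ENNReal.ofReal_mul (by positivity), ENNReal.ofReal_toReal hf]

end PseudoPoincare

end MWGraph

theorem mainTheorem8_general {V : Type*} {G : MWGraph V} {K T : ℝ} (hK : 0 < K) (hT : 0 < T)
    {ρ : V → ℝ} (hG : G.BoundedDegree) (hCD : G.CD ρ ⊤)
    (hkato : G.kato T (fun x => (ρ x - K)⁻) ≤
      ENNReal.ofReal (1 / 4 * (1 - Real.exp (-(K * T / 2)))))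
    (f : V → ℝ) {t : ℝ} (ht : 0 ≤ t) :
    G.norm1 (fun x => f x - G.heat t f x) ≤
      ENNReal.ofReal (2 * √2 * √t) * G.norm1 (fun x => √(G.Gam f f x)) := by
  by_cases hf : G.norm1 (fun x => √(G.Gam f f x)) = ∞
  · rcases ht.eq_or_lt with rfl | ht
    · simp [MWGraph.heat_zero, MWGraph.norm1]
    · rw [hf, ENNReal.mul_top (ENNReal.ofReal_pos.2 (by positivity)).ne']
      exact le_top
  · let _ : TopologicalSpace V := ⊥
    have : DiscreteTopology V := ⟨rfl⟩
    obtain ⟨D, hD⟩ := hG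
    exact MWGraph.norm1_sub_heat_le (D := D) (fun x => hD ⟨x, rfl⟩) (fun g _ hs =>
      MWGraph.smul_carreDuChamp_opExp_boundedLap_le _ hK hT hCD hkato g hs) hf ht

theorem mainTheorem8 (K T : ℝ) (hK : 0 < K) (hT : 0 < T) :
    ∃ c : ℝ, 0 < c ∧
      ∀ (V : Type*) [Countable V] (G : MWGraph V) (ρ : V → ℝ),
        G.BoundedDegree →
        G.CD ρ ⊤ →
        G.kato T (fun x => (ρ x - K)⁻) < ENNReal.ofReal (1 / 4 * (1 - Real.exp (-(K * T / 2)))) →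
        ∀ (f : V → ℝ) (t : ℝ), 0 ≤ t →
          G.norm1 (fun x => f x - G.heat t f x) ≤
            ENNReal.ofReal (c * Real.sqrt t) * G.norm1 (fun x => Real.sqrt (G.Gam f f x)) :=
  ⟨2 * √2, by positivity, fun _ _ _ _ hG hCD hkato f _ ht =>
    mainTheorem8_general hK hT hG hCD hkato.le f ht⟩
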